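/- Let $V$ be a real locally convex vector space whose topology is generated by a family of seminorms $(\xi_i)_{i\in I}$, and fix a symmetric system of cross seminorms on the tensor powers of $V$, i.e. seminorms $\xi_{i_1}\otimes\cdots\otimes\xi_{i_m}$ on $V^{\otimes m}$ for all $m\ge 0$ and $i_1,\dots,i_m\in I$ (the absolute value on $V^{\otimes 0}=\mathbb R$ for $m=0$, and $\xi_{i_1}$ for $m=1$) that are multiplicative, $\xi_{i_1}\otimes\cdots\otimes\xi_{i_{l+m}}(a\otimes b)=\xi_{i_1}\otimes\cdots\otimes\xi_{i_l}(a)\,\xi_{i_{l+1}}\otimes\cdots\otimes\xi_{i_{l+m}}(b)$, and invariant under simultaneous permutation of the indices and the tensor factors. Let $V^{\hat\otimes m}$ be the (Hausdorff) completion of $V^{\otimes m}$ for these seminorms. A tree $\mathfrak t$ is a finite non-planar rooted tree, regarded up to isomorphism as a partially ordered set with the root as its least element; its degree $|\mathfrak t|$ is its number of non-root vertices, and $\mathrm{SG}(\mathfrak t)$ is the group of order-preserving bijections of its non-root vertices. Put $V^{\hat\otimes\mathfrak t}:=V^{\hat\otimes|\mathfrak t|}/\ker(\mathrm{sym}_{\mathrm{SG}(\mathfrak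 t)})$, where the tensor factors are indexed by the non-root vertices and $\mathrm{sym}_G=|G|^{-1}\sum_{\sigma\in G}\sigma$; similarly let $V^{\hat\otimes\mathfrak t}\hat\otimes V^{\hat\otimes\mathfrak s}:=V^{\hat\otimes(|\mathfrak t|+|\mathfrak s|)}/\ker(\mathrm{sym}_{\mathrm{SG}(\mathfrak t)\times\mathrm{SG}(\mathfrak s)})$. The completed Grossman-Larson Hopf algebra $\widehat{\mathcal H}_{GL}(V)$ has underlying space $\widehat{\mathfrak{Tr}}(V)=\prod_{\mathfrak t}V^{\hat\otimes\mathfrak t}$, and $\widehat{\mathfrak{Tr}}(V)\hat\otimes\widehat{\mathfrak{Tr}}(V)=\prod_{\mathfrak t,\mathfrak s}V^{\hat\otimes\mathfrak t}\hat\otimes V^{\hat\otimes\mathfrak s}$. On labelled trees, $\mathbf t\circ\mathbf s$ is the labelled tree obtained by identifying the roots, and, if $\mathbf t=\mathbf t_1\circ\cdots\circ\mathbf t_m$ where the root of each $\mathbf t_j$ has exactly one child, $$\Delta_{GL}(\mathbf t)=\sum_{J\subseteq\{1,\dots,m\}}\Big(\mathop{\bigcirc}_{j\in J}\mathbf t_j\Big)\otimes\Big(\mathop{\bigcirc}_{j\notin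 J}\mathbf t_j\Big);$$ both are extended (bi)linearly and continuously to $\widehat{\mathfrak{Tr}}(V)$. Powers $\mathbf x^{\circ k}$ are taken with respect to $\circ$, and $\mathbf x^{\circ 0}=\mathbf 1$ is the tree consisting only of its root. Let $\pi_k$ be the projection of $\widehat{\mathfrak{Tr}}(V)$ onto the trees whose root has exactly $k$ children, let $\pi^{(n)}$ be the projection onto the quotient of $\widehat{\mathfrak{Tr}}(V)$ by the subspace of all elements supported on trees of degree greater than $n$ (this quotient being identified, as a vector space, with the subspace of all elements supported on trees of degree at most $n$), and let $\pi^{(n)}_k=\pi^{(n)}\circ\pi_k$. Let $\mathbf t\in\widehat{\mathcal H}_{GL}(V)$ be group-like in the sense that $\Delta_{GL}(\mathbf t)=\mathbf t\otimes\mathbf t$. Then for all integers $n\ge 0$ and $k\ge 0$, where in the case $k=0$ it is assumed in addition that $\mathbf t\neq 0$, there is an $\mathfrak r\in\widehat{\mathfrak{Tr}}(V)$ with $$\pi^{(n)}_k(\mathbf t)=\frac{\big(\pi^{(n)}_1(\mathbf t)\big)^{\circ k}}{k!}+\mathfrak r\qquad\text{and}\qquad\pi^{(n)}(\mathfrak r)=0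 .$$ -/

import Mathlib

open scoped TensorProduct
open UniformSpace

/-! ### Non-planar rooted trees -/

/-- A finite partially ordered set with a unique minimal element (the root) in which the
elements strictly below any given element are totally ordered. -/
structure RootedPoset where
  carrier : Type
  [order : PartialOrder carrier]
  [finite : Finite carrier]
  existsUnique_isMin : ∃! r : carrier, IsMin r
  isChain_Iio : ∀ v : carrier, IsChain (· ≤ ·) (Set.Iio v)

attribute [instance] RootedPoset.order RootedPoset.finite

namespace RootedPoset

/-- The root: the unique minimal element. -/
noncomputable def root (T : RootedPoset) : T.carrier := T.existsUnique_isMin.choose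

/-- The set `v(T)` of vertices other than the root, with the order inherited from `T`. -/
abbrev Vert (T : RootedPoset) : Type := {v : T.carrier // v ≠ T.root}

/-- Two rooted posets are equivalent if there is an order isomorphism between them. -/
instance setoid : Setoid RootedPoset where
  r S T := Nonempty (S.carrier ≃o T.carrier)
  iseqv := ⟨fun _ => ⟨OrderIso.refl _⟩, fun ⟨e⟩ => ⟨e.symm⟩, fun ⟨e⟩ ⟨f⟩ => ⟨e.trans f⟩⟩

theorem root_le (T : RootedPoset) (v : T.carrier) : T.root ≤ v := by
  obtain ⟨m, hm, hmin⟩ := (Set.finite_univ (α := T.carrier)).exists_le_minimal (Set.mem_univ v)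
  have h1 : IsMin m := fun b hb => hmin.2 (Set.mem_univ b) hb
  have h2 : m = T.root := T.existsUnique_isMin.choose_spec.2 m h1
  exact h2 ▸ hm

end RootedPoset

/-- A (non-planar rooted) tree: an equivalence class of rooted posets. -/
def RTree : Type 1 := Quotient RootedPoset.setoid

namespace RTree

/-- A fixed representative of a tree. -/
noncomputable def rep (t : RTree) : RootedPoset := Quotient.out t

/-- The non-root vertices of (the fixed representative of) `t`. -/
abbrev Vert (t : RTree) : Type := t.rep.Vert

/-- The degree `|t|`: the number of non-root vertices. -/
noncomputable def deg (t : RTree) : ℕ := Nat.card t.Vert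

/-- The children of the root: the vertices that cover the root. -/
def rootChildren (t : RTree) : Set t.Vert := {w | t.rep.root ⋖ w.1}

/-- The number of children of the root. -/
noncomputable def numRootChildren (t : RTree) : ℕ := t.rootChildren.ncard

/-- The vertices that lie above (or in) a given set `C` of vertices. If `C` is a set of children
of the root, these are the vertices of the branches of `t` that start in `C`. -/
def branches (t : RTree) (C : Set t.Vert) : Set t.Vert := {v | ∃ c ∈ C, c ≤ v}

/-- Every vertex lies in exactly one branch, so the vertices that do not lie in the branches
starting in `C` are those in the branches starting in the remaining children of the root. -/
theorem compl_branches (t : RTree) (C : Set t.Vert) (hC : C ⊆ t.rootChildren) :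
    (t.branches C)ᶜ = t.branches (t.rootChildren \ C) := by
  ext v
  constructor
  · intro hv
    obtain ⟨m, hm, hmin⟩ := (Set.finite_univ (α := t.Vert)).exists_le_minimal (Set.mem_univ v)
    have hmC : m ∈ t.rootChildren := by
      refine ⟨lt_of_le_of_ne (t.rep.root_le _) (Ne.symm m.2), ?_⟩
      intro c hc1 hc2
      exact absurd (hmin.2 (Set.mem_univ ⟨c, hc1.ne'⟩) hc2.le) (not_le_of_gt hc2)
    exact ⟨m, ⟨hmC, fun h => hv ⟨m, h, hm⟩⟩, hm⟩
  · rintro ⟨c, ⟨hc, hcC⟩, hcv⟩ ⟨d, hd, hdv⟩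
    have hd' := hC hd
    have hne : c ≠ d := fun h => hcC (h ▸ hd)
    have hcd : c.1 ≤ d.1 ∨ d.1 ≤ c.1 := by
      rcases eq_or_lt_of_le hcv with rfl | h1
      · exact Or.inr hdv
      rcases eq_or_lt_of_le hdv with rfl | h2
      · exact Or.inl hcv
      exact (t.rep.isChain_Iio v.1).total h1 h2
    rcases hcd with h | h
    · exact hd'.2 hc.1 (lt_of_le_of_ne h fun h' => hne (Subtype.ext h'))
    · exact hc.2 hd'.1 (lt_of_le_of_ne h fun h' => hne (Subtype.ext h'.symm))

open Classical in
/-- As an ordered set, the set of non-root vertices is the disjoint union of the branches starting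
in `C` and the other branches. -/
noncomputable def splitIso (t : RTree) (C : Set t.Vert) (hC : C ⊆ t.rootChildren) :
    t.Vert ≃o (t.branches C ⊕ ((t.branches C)ᶜ : Set t.Vert)) where
  toEquiv := (Equiv.Set.sumCompl (t.branches C)).symm
  map_rel_iff' {v w} := by
    obtain ⟨v, rfl⟩ := (Equiv.Set.sumCompl (t.branches C)).surjective v
    obtain ⟨w, rfl⟩ := (Equiv.Set.sumCompl (t.branches C)).surjective w
    simp only [Equiv.symm_apply_apply]
    rcases v with v | v <;> rcases w with w | w
    · simp
    · simp only [Sum.not_inl_le_inr, Equiv.Set.sumCompl_apply_inl, Equiv.Set.sumCompl_apply_inr,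
        false_iff]
      intro h
      obtain ⟨c, hc, hcv⟩ := v.2
      exact w.2 ⟨c, hc, hcv.trans h⟩
    · simp only [Sum.not_inr_le_inl, Equiv.Set.sumCompl_apply_inl, Equiv.Set.sumCompl_apply_inr,
        false_iff]
      intro h
      obtain ⟨c, hc, hcv⟩ := (t.compl_branches C hC).subset v.2
      exact (t.compl_branches C hC).superset ⟨c, hc, hcv.trans h⟩ w.2
    · simp

/-- A tree is determined by the order on its non-root vertices. -/
theorem eq_of_orderIso {s t : RTree} (e : s.Vert ≃o t.Vert) : s = t := by
  classical
  have key : ∀ {S T : RootedPoset} (f : S.Vert ≃o T.Vert), ∃ g : S.carrier → T.carrier,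
      g S.root = T.root ∧ ∀ v : S.Vert, g v.1 = (f v).1 := by
    intro S T f
    refine ⟨fun x => if h : x = S.root then T.root else (f ⟨x, h⟩).1, by simp, fun v => ?_⟩
    simp [v.2]
  obtain ⟨g, hg0, hg⟩ := key e
  obtain ⟨g', hg0', hg'⟩ := key e.symm
  have h1 : ∀ x, g' (g x) = x := by
    intro x
    by_cases h : x = s.rep.root
    · rw [h, hg0, hg0']
    · rw [hg ⟨x, h⟩, hg' (e ⟨x, h⟩), e.symm_apply_apply]
  have h2 : ∀ x, g (g' x) = x := by
    intro x
    by_cases h : x = t.rep.root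
    · rw [h, hg0', hg0]
    · rw [hg' ⟨x, h⟩, hg (e.symm ⟨x, h⟩), e.apply_symm_apply]
  have h3 : ∀ x y, g x ≤ g y ↔ x ≤ y := by
    intro x y
    by_cases hx : x = s.rep.root
    · subst hx
      rw [hg0]
      exact ⟨fun _ => s.rep.root_le _, fun _ => t.rep.root_le _⟩
    by_cases hy : y = s.rep.root
    · subst hy
      rw [hg0, hg ⟨x, hx⟩]
      constructor
      · intro h
        exact absurd (le_antisymm h (t.rep.root_le _)) (e ⟨x, hx⟩).2
      · intro h
        exact absurd (le_antisymm h (s.rep.root_le _)) hx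
    rw [hg ⟨x, hx⟩, hg ⟨y, hy⟩]
    exact e.le_iff_le (x := ⟨x, hx⟩) (y := ⟨y, hy⟩)
  have : s.rep ≈ t.rep := ⟨⟨⟨g, g', h1, h2⟩, fun {x y} => h3 x y⟩⟩
  have h := Quotient.sound this
  exact (Quotient.out_eq s).symm.trans (h.trans (Quotient.out_eq t))

/-- For a given tree `u` there are only finitely many pairs `(a, b)` with `a ∘ b = u`. -/
theorem finite_decompositions (u : RTree) :
    {p : RTree × RTree | Nonempty ((p.1.Vert ⊕ p.2.Vert) ≃o u.Vert)}.Finite := by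
  classical
  let f : (RTree × RTree) → Set u.Vert × Set u.Vert := fun p =>
    if h : Nonempty ((p.1.Vert ⊕ p.2.Vert) ≃o u.Vert) then
      (Set.range fun a => h.some (Sum.inl a), Set.range fun a => h.some (Sum.inr a)) else (∅, ∅)
  have iso : ∀ {α β : Type} [PartialOrder α] [PartialOrder β] (g : α ↪o u.Vert)
      (h : β ↪o u.Vert), Set.range g = Set.range h → Nonempty (α ≃o β) := by
    intro α β _ _ g h hgh
    exact ⟨(g.orderIso.trans (OrderIso.setCongr _ _ hgh)).trans h.orderIso.symm⟩
  refine Set.Finite.of_finite_image (f := f) (Set.toFinite _) ?_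
  rintro ⟨a, b⟩ hp ⟨a', b'⟩ hq hpq
  have hp' : Nonempty ((a.Vert ⊕ b.Vert) ≃o u.Vert) := hp
  have hq' : Nonempty ((a'.Vert ⊕ b'.Vert) ≃o u.Vert) := hq
  simp only [f, dif_pos hp', dif_pos hq', Prod.mk.injEq] at hpq
  have ea := iso
    (OrderEmbedding.ofMapLEIff (fun x : a.Vert => hp'.some (Sum.inl x)) (by simp))
    (OrderEmbedding.ofMapLEIff (fun x : a'.Vert => hq'.some (Sum.inl x)) (by simp)) hpq.1
  have eb := iso
    (OrderEmbedding.ofMapLEIff (fun x : b.Vert => hp'.some (Sum.inr x)) (by simp))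
    (OrderEmbedding.ofMapLEIff (fun x : b'.Vert => hq'.some (Sum.inr x)) (by simp)) hpq.2
  exact Prod.ext (eq_of_orderIso ea.some) (eq_of_orderIso eb.some)

end RTree

/-! ### Symmetric systems of cross seminorms and completed tensor powers -/

section Tensor

variable {V : Type*} [AddCommGroup V] [Module ℝ V] {I : Type*}

/-- The action of a permutation on a tensor power:
`σ (v₁ ⊗ ⋯ ⊗ vₖ) = v_{σ 1} ⊗ ⋯ ⊗ v_{σ k}`. -/
noncomputable def permTensor {k : ℕ} (σ : Equiv.Perm (Fin k)) :
    (⨂[ℝ] _ : Fin k, V) →ₗ[ℝ] (⨂[ℝ] _ : Fin k, V) :=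
  (PiTensorProduct.reindex ℝ (fun _ : Fin k => V) σ.symm).toLinearMap

theorem permTensor_tprod {k : ℕ} (σ : Equiv.Perm (Fin k)) (v : Fin k → V) :
    permTensor σ (PiTensorProduct.tprod ℝ v) = PiTensorProduct.tprod ℝ fun j => v (σ j) := by
  simp [permTensor, PiTensorProduct.reindex_tprod]

/-- A symmetric system of cross seminorms on the tensor powers of `V`, built on a family
`(ξ i)` of seminorms on `V`: the seminorm `ξ_{i₁} ⊗ ⋯ ⊗ ξ_{iₖ}` on `V^{⊗ k}` is `p k i`. -/
structure SymmCrossSeminorms (ξ : SeminormFamily ℝ V I) where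
  p : ∀ k : ℕ, (Fin k → I) → Seminorm ℝ (⨂[ℝ] _ : Fin k, V)
  /-- On `V^{⊗ 0} = ℝ` the seminorm is the absolute value. -/
  p_zero : ∀ i : Fin 0 → I, p 0 i (PiTensorProduct.tprod ℝ fun j => j.elim0) = 1
  /-- On `V^{⊗ 1} = V` the seminorms are the given ones. -/
  p_one : ∀ (i : Fin 1 → I) (v : Fin 1 → V), p 1 i (PiTensorProduct.tprod ℝ v) = ξ (i 0) (v 0)
  cross : ∀ (m n : ℕ) (i : Fin m → I) (j : Fin n → I)
    (a : ⨂[ℝ] _ : Fin m, V) (b : ⨂[ℝ] _ : Fin n, V),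
    p (m + n) (Fin.append i j) (TensorPower.mulEquiv (a ⊗ₜ[ℝ] b)) = p m i a * p n j b
  symm : ∀ (k : ℕ) (σ : Equiv.Perm (Fin k)) (i : Fin k → I) (a : ⨂[ℝ] _ : Fin k, V),
    p k i a = p k (i ∘ σ) (permTensor σ a)

variable {ξ : SeminormFamily ℝ V I} (N : SymmCrossSeminorms ξ)

namespace SymmCrossSeminorms

/-- The cross seminorm attached to `i : α → I` on the tensor power of `V` indexed by an arbitrary
finite set `α`. By symmetry the enumeration of `α` does not matter. -/
noncomputable def seminorm (α : Type) [Finite α] (i : α → I) : Seminorm ℝ (⨂[ℝ] _ : α, V) :=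
  (N.p (Nat.card α) (i ∘ (Finite.equivFin α).symm)).comp
    (PiTensorProduct.reindex ℝ (fun _ : α => V) (Finite.equivFin α)).toLinearMap

theorem seminorm_eq {α : Type} [Finite α] {k : ℕ} (e : α ≃ Fin k) (i : α → I)
    (a : ⨂[ℝ] _ : α, V) :
    N.seminorm α i a = N.p k (i ∘ e.symm) (PiTensorProduct.reindex ℝ (fun _ : α => V) e a) := by
  obtain rfl : Nat.card α = k := by simpa using Nat.card_congr e
  rw [seminorm, Seminorm.comp_apply,
    N.symm _ (e.symm.trans (Finite.equivFin α)) (i ∘ (Finite.equivFin α).symm)]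
  congr 1
  · congr 1
    ext j
    simp
  · have h := PiTensorProduct.reindex_reindex (R := ℝ) (s := fun _ : α => V) (Finite.equivFin α)
      (e.symm.trans (Finite.equivFin α)).symm a
    refine h.trans ?_
    have he : (Finite.equivFin α).trans (e.symm.trans (Finite.equivFin α)).symm = e := by
      ext x; simp
    rw [he]

theorem seminorm_reindex {α β : Type} [Finite α] [Finite β] (e : α ≃ β) (i : β → I)
    (a : ⨂[ℝ] _ : α, V) :
    N.seminorm β i (PiTensorProduct.reindex ℝ (fun _ : α => V) e a) = N.seminorm α (i ∘ e) a := by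
  rw [N.seminorm_eq (Finite.equivFin β) i, N.seminorm_eq (e.trans (Finite.equivFin β)) (i ∘ e)]
  have h := PiTensorProduct.reindex_reindex (R := ℝ) (s := fun _ : α => V) e (Finite.equivFin β) a
  congr 1
  · congr 1
    ext j
    simp

theorem reindex_tmulEquiv {α β γ δ : Type} (e : α ≃ γ) (f : β ≃ δ)
    (a : ⨂[ℝ] _ : α, V) (b : ⨂[ℝ] _ : β, V) :
    PiTensorProduct.reindex ℝ (fun _ : α ⊕ β => V) (Equiv.sumCongr e f)
        (PiTensorProduct.tmulEquiv ℝ V (a ⊗ₜ[ℝ] b)) =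
      PiTensorProduct.tmulEquiv ℝ V ((PiTensorProduct.reindex ℝ (fun _ : α => V) e a) ⊗ₜ[ℝ]
        (PiTensorProduct.reindex ℝ (fun _ : β => V) f b)) := by
  induction a using PiTensorProduct.induction_on with
  | smul_tprod r v =>
    induction b using PiTensorProduct.induction_on with
    | smul_tprod s w =>
      simp only [← TensorProduct.smul_tmul', TensorProduct.tmul_smul, map_smul,
        PiTensorProduct.tmulEquiv_apply, PiTensorProduct.reindex_tprod]
      congr 3
      funext x
      rcases x with x | x <;> rfl
    | add x y hx hy => simp only [TensorProduct.tmul_add, map_add, hx, hy]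
  | add x y hx hy => simp only [TensorProduct.add_tmul, map_add, hx, hy]

theorem seminorm_tmul {α β : Type} [Finite α] [Finite β] (i : α ⊕ β → I)
    (a : ⨂[ℝ] _ : α, V) (b : ⨂[ℝ] _ : β, V) :
    N.seminorm (α ⊕ β) i (PiTensorProduct.tmulEquiv ℝ V (a ⊗ₜ[ℝ] b)) =
      N.seminorm α (i ∘ Sum.inl) a * N.seminorm β (i ∘ Sum.inr) b := by
  set e := Finite.equivFin α
  set f := Finite.equivFin β
  rw [N.seminorm_eq ((Equiv.sumCongr e f).trans finSumFinEquiv), N.seminorm_eq e,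
    N.seminorm_eq f, ← N.cross]
  congr 1
  · congr 1
    ext j
    refine Fin.addCases (fun j => ?_) (fun j => ?_) j <;> simp
  · have h := PiTensorProduct.reindex_reindex (R := ℝ) (s := fun _ : α ⊕ β => V)
      (Equiv.sumCongr e f) finSumFinEquiv (PiTensorProduct.tmulEquiv ℝ V (a ⊗ₜ[ℝ] b))
    refine h.symm.trans ?_
    rw [reindex_tmulEquiv]
    rfl

end SymmCrossSeminorms

/-- The algebraic tensor power `V^{⊗ α}` indexed by a finite set `α`, to be equipped with the
topology generated by the cross seminorms in `N`. -/
def TensorPow (_N : SymmCrossSeminorms ξ) (α : Type) : Type _ := ⨂[ℝ] _ : α, V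

namespace TensorPow

noncomputable instance (α : Type) : AddCommGroup (TensorPow N α) :=
  inferInstanceAs (AddCommGroup (⨂[ℝ] _ : α, V))

noncomputable instance (α : Type) : Module ℝ (TensorPow N α) :=
  inferInstanceAs (Module ℝ (⨂[ℝ] _ : α, V))

/-- The cross seminorms as a family of seminorms on `V^{⊗ α}`. -/
noncomputable def family (α : Type) [Finite α] : SeminormFamily ℝ (TensorPow N α) (α → I) :=
  fun i => N.seminorm α i

noncomputable instance (α : Type) [Finite α] : TopologicalSpace (TensorPow N α) :=
  (family N α).moduleFilterBasis.topology

theorem withSeminorms (α : Type) [Finite α] : WithSeminorms (family N α) := ⟨rfl⟩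

instance (α : Type) [Finite α] : IsTopologicalAddGroup (TensorPow N α) :=
  (withSeminorms N α).topologicalAddGroup

instance (α : Type) [Finite α] : ContinuousSMul ℝ (TensorPow N α) :=
  (withSeminorms N α).continuousSMul

noncomputable instance (α : Type) [Finite α] : UniformSpace (TensorPow N α) :=
  IsTopologicalAddGroup.rightUniformSpace (TensorPow N α)

instance (α : Type) [Finite α] : IsUniformAddGroup (TensorPow N α) :=
  isUniformAddGroup_of_addCommGroup

instance (α : Type) [Finite α] : UniformContinuousConstSMul ℝ (TensorPow N α) :=
  uniformContinuousConstSMul_of_continuousConstSMul ℝ _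

/-- Relabelling of the tensor factors along a bijection. -/
noncomputable def relabel {α β : Type} [Finite α] [Finite β] (e : α ≃ β) :
    TensorPow N α →L[ℝ] TensorPow N β where
  toLinearMap := (PiTensorProduct.reindex ℝ (fun _ : α => V) e).toLinearMap
  cont := (withSeminorms N β).continuous_of_continuous_comp _ fun i =>
    ((withSeminorms N α).continuous_seminorm (i ∘ e)).congr fun a =>
      (N.seminorm_reindex e i a).symm

/-- The bilinear map `(a, b) ↦ a ⊗ b` from `V^{⊗ α} × V^{⊗ β}` to `V^{⊗ (α ⊔ β)}`. -/
noncomputable def tmul (α β : Type) :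
    TensorPow N α →ₗ[ℝ] TensorPow N β →ₗ[ℝ] TensorPow N (α ⊕ β) :=
  (TensorProduct.mk ℝ (⨂[ℝ] _ : α, V) (⨂[ℝ] _ : β, V)).compr₂
    (PiTensorProduct.tmulEquiv ℝ V).toLinearMap

theorem continuous_tmul (α β : Type) [Finite α] [Finite β] :
    Continuous fun x : TensorPow N α × TensorPow N β => tmul N α β x.1 x.2 := by
  have hs : ∀ (i : α ⊕ β → I) (a : TensorPow N α) (b : TensorPow N β),
      family N (α ⊕ β) i (tmul N α β a b) =
        family N α (i ∘ Sum.inl) a * family N β (i ∘ Sum.inr) b :=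
    fun i a b => N.seminorm_tmul i a b
  rw [continuous_iff_continuousAt]
  rintro ⟨a₀, b₀⟩
  refine ((withSeminorms N (α ⊕ β)).tendsto_nhds _ _).2 fun i ε hε => ?_
  have hp := (withSeminorms N α).continuous_seminorm (i ∘ Sum.inl)
  have hq := (withSeminorms N β).continuous_seminorm (i ∘ Sum.inr)
  have hc : Continuous fun x : TensorPow N α × TensorPow N β =>
      family N α (i ∘ Sum.inl) (x.1 - a₀) * family N β (i ∘ Sum.inr) x.2 +
        family N α (i ∘ Sum.inl) a₀ * family N β (i ∘ Sum.inr) (x.2 - b₀) :=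
    ((hp.comp (continuous_fst.sub continuous_const)).mul (hq.comp continuous_snd)).add
      (continuous_const.mul (hq.comp (continuous_snd.sub continuous_const)))
  have ht := hc.tendsto (a₀, b₀)
  simp only [sub_self, map_zero, zero_mul, mul_zero, add_zero] at ht
  filter_upwards [ht.eventually (gt_mem_nhds hε)] with x hx
  refine lt_of_le_of_lt ?_ hx
  have hsplit : tmul N α β x.1 x.2 - tmul N α β a₀ b₀ =
      tmul N α β (x.1 - a₀) x.2 + tmul N α β a₀ (x.2 - b₀) := by
    simp only [map_sub, LinearMap.sub_apply]; abel
  rw [hsplit]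
  refine (map_add_le_add _ _ _).trans ?_
  rw [hs, hs]

/-- The unit `1` of `V^{⊗ ∅} = ℝ`. -/
noncomputable def one : TensorPow N Empty :=
  (PiTensorProduct.tprod ℝ fun e => e.elim : ⨂[ℝ] _ : Empty, V)

end TensorPow

/-- The completed tensor power: the (Hausdorff) completion of `V^{⊗ α}`. -/
abbrev CTensorPow (α : Type) [Finite α] : Type _ := Completion (TensorPow N α)

namespace CTensorPow

/-- Relabelling of tensor factors, extended continuously to the completions. -/
noncomputable def relabel {α β : Type} [Finite α] [Finite β] (e : α ≃ β) :
    CTensorPow N α →L[ℝ] CTensorPow N β :=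
  (TensorPow.relabel N e).completion

/-- The map `(a, b) ↦ a ⊗ b`, extended continuously to the completions. -/
noncomputable def tmul {α β : Type} [Finite α] [Finite β] (x : CTensorPow N α)
    (y : CTensorPow N β) : CTensorPow N (α ⊕ β) :=
  ((Completion.isDenseInducing_coe (α := TensorPow N α)).prodMap
    (Completion.isDenseInducing_coe (α := TensorPow N β))).extend
    (fun z => ((TensorPow.tmul N α β z.1 z.2 : TensorPow N (α ⊕ β)) : CTensorPow N (α ⊕ β)))
    (x, y)

theorem tmul_coe {α β : Type} [Finite α] [Finite β] (a : TensorPow N α) (b : TensorPow N β) :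
    tmul N (a : CTensorPow N α) (b : CTensorPow N β) = (TensorPow.tmul N α β a b :) :=
  ((Completion.isDenseInducing_coe (α := TensorPow N α)).prodMap
    (Completion.isDenseInducing_coe (α := TensorPow N β))).extend_eq
    ((Completion.continuous_coe _).comp (TensorPow.continuous_tmul N α β)) (a, b)

theorem continuous_tmul (α β : Type) [Finite α] [Finite β] :
    Continuous fun x : CTensorPow N α × CTensorPow N β => tmul N x.1 x.2 := by
  let m : TensorPow N α →+ TensorPow N β →+ CTensorPow N (α ⊕ β) :=
    AddMonoidHom.mk' (fun a => (Completion.toCompl (α := TensorPow N (α ⊕ β))).comp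
      (TensorPow.tmul N α β a).toAddMonoidHom) (by
        intro a b; ext c
        simpa using Completion.coe_add (TensorPow.tmul N α β a c) (TensorPow.tmul N α β b c))
  have hm : Continuous fun p : TensorPow N α × TensorPow N β => m p.1 p.2 :=
    (Completion.continuous_coe _).comp (TensorPow.continuous_tmul N α β)
  have da : IsDenseInducing (Completion.toCompl : TensorPow N α → CTensorPow N α) :=
    Completion.isDenseInducing_coe
  have db : IsDenseInducing (Completion.toCompl : TensorPow N β → CTensorPow N β) :=
    Completion.isDenseInducing_coe
  exact (da.extend_Z_bilin db hm :)

/-- The symmetrisation `sym_G = |G|⁻¹ ∑_{σ ∈ G} σ` on `V^{⊗ α}`, for a group `G` of permutations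
of `α`, extended continuously to the completion. -/
noncomputable def sym {α : Type} [Finite α] (G : Subgroup (Equiv.Perm α)) :
    CTensorPow N α →L[ℝ] CTensorPow N α :=
  haveI := Fintype.ofFinite G
  ((Nat.card G : ℝ)⁻¹ • ∑ σ : G, TensorPow.relabel N (σ : Equiv.Perm α)).completion

theorem sym_sym {α : Type} [Finite α] (G : Subgroup (Equiv.Perm α)) (x : CTensorPow N α) :
    sym N G (sym N G x) = sym N G x := by
  have hcard : (Nat.card G : ℝ) ≠ 0 := by exact_mod_cast Nat.card_pos.ne'
  have hcomp : ∀ (σ τ : G) (a : TensorPow N α),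
      TensorPow.relabel N (σ : Equiv.Perm α) (TensorPow.relabel N (τ : Equiv.Perm α) a) =
        TensorPow.relabel N ((σ * τ : G) : Equiv.Perm α) a := fun σ τ a =>
    PiTensorProduct.reindex_reindex (R := ℝ) (s := fun _ : α => V) (τ : Equiv.Perm α)
      (σ : Equiv.Perm α) a
  refine Completion.induction_on x (isClosed_eq (by fun_prop) (by fun_prop)) fun a => ?_
  simp only [sym, ContinuousLinearMap.completion_apply_coe]
  congr 1
  simp only [smul_apply, sum_apply, map_smul, map_sum, hcomp]
  have hsum : ∀ (_ : Fintype G) (τ : G), ∑ σ : G, TensorPow.relabel N ((σ * τ : G) : Equiv.Perm α) a =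
      ∑ σ : G, TensorPow.relabel N (σ : Equiv.Perm α) a := fun _ τ =>
    Equiv.sum_comp (Equiv.mulRight τ) fun σ : G => TensorPow.relabel N (σ : Equiv.Perm α) a
  simp only [hsum, Finset.sum_const, Finset.card_univ, ← Nat.card_eq_fintype_card]
  rw [← Nat.cast_smul_eq_nsmul ℝ, smul_smul, smul_smul, inv_mul_cancel₀ hcard, one_mul]

end CTensorPow

/-- The quotient of the completed tensor power by the kernel of the symmetrisation. -/
abbrev SymQuot {α : Type} [Finite α] (G : Subgroup (Equiv.Perm α)) : Type _ :=
  CTensorPow N α ⧸ LinearMap.ker (CTensorPow.sym N G).toLinearMap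

namespace SymQuot

/-- The class of a tensor. -/
noncomputable def mk {α : Type} [Finite α] (G : Subgroup (Equiv.Perm α)) :
    CTensorPow N α →ₗ[ℝ] SymQuot N G :=
  (LinearMap.ker (CTensorPow.sym N G).toLinearMap).mkQ

/-- The symmetric representative: the linear map induced by `sym_G`, which identifies
the quotient with the image of `sym_G`. -/
noncomputable def rep {α : Type} [Finite α] (G : Subgroup (Equiv.Perm α)) :
    SymQuot N G →ₗ[ℝ] CTensorPow N α :=
  (LinearMap.ker (CTensorPow.sym N G).toLinearMap).liftQ (CTensorPow.sym N G).toLinearMap le_rfl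

theorem rep_mk {α : Type} [Finite α] (G : Subgroup (Equiv.Perm α)) (x : CTensorPow N α) :
    rep N G (mk N G x) = CTensorPow.sym N G x := rfl

theorem mk_rep {α : Type} [Finite α] (G : Subgroup (Equiv.Perm α)) (x : SymQuot N G) :
    mk N G (rep N G x) = x := by
  obtain ⟨y, rfl⟩ := (LinearMap.ker (CTensorPow.sym N G).toLinearMap).mkQ_surjective x
  change mk N G (CTensorPow.sym N G y) = mk N G y
  rw [← sub_eq_zero, ← map_sub]
  refine (Submodule.Quotient.mk_eq_zero _).2 ?_
  simp [CTensorPow.sym_sym]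

end SymQuot

/-! ### Labelled trees -/

/-- The group of order-preserving bijections of a finite partially ordered set. -/
def symmetryGroup (α : Type) [PartialOrder α] : Subgroup (Equiv.Perm α) where
  carrier := {σ | ∀ v w, σ v ≤ σ w ↔ v ≤ w}
  mul_mem' {σ τ} hσ hτ v w := (hσ (τ v) (τ w)).trans (hτ v w)
  one_mem' _ _ := Iff.rfl
  inv_mem' {σ} hσ v w := by simpa using (hσ (σ⁻¹ v) (σ⁻¹ w)).symm

/-- The image of `SG(α) × SG(β)` in the group of permutations of `α ⊔ β`. -/
def symmetryGroupProd (α β : Type) [PartialOrder α] [PartialOrder β] :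
    Subgroup (Equiv.Perm (α ⊕ β)) :=
  ((symmetryGroup α).prod (symmetryGroup β)).map (Equiv.Perm.sumCongrHom α β)

/-- The completed `t`-tensor power of `V`. -/
abbrev LTree (t : RTree) : Type _ := SymQuot N (symmetryGroup t.Vert)

/-- The completed tensor product of the completed `a`-tensor power and the completed `b`-tensor
power of `V`: both this and the tensor product of the two algebraic quotients are obtained from
`V^{⊗ (|a| + |b|)}` by dividing out the kernel of `sym_{SG(a)} ⊗ sym_{SG(b)}`. -/
abbrev LTree₂ (a b : RTree) : Type _ := SymQuot N (symmetryGroupProd a.Vert b.Vert)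

/-- The completed tree algebra, as a topological vector space: the product over all trees
of the completed `t`-tensor powers of `V` (the closure of their direct sum). -/
abbrev TreeSeries : Type _ := ∀ t : RTree, LTree N t

/-- The completed tensor product of the completed tree algebra with itself. -/
abbrev TreeSeries₂ : Type _ := ∀ a b : RTree, LTree₂ N a b

namespace TreeSeries

open Classical in
/-- The element of the tree algebra given by the tree whose ordered set of non-root vertices is
`α`, with labels given by the tensor `x`: its component at the tree `u` is the class of `x` if `u`
is the tree in question, and zero otherwise. -/
noncomputable def ofForest {α : Type} [PartialOrder α] [Finite α] (x : CTensorPow N α) :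
    TreeSeries N := fun u =>
  if h : Nonempty (α ≃o u.Vert) then
    SymQuot.mk N _ (CTensorPow.relabel N h.some.toEquiv x)
  else 0

open Classical in
/-- The element `P ⊗ Q` for trees `P` and `Q` with ordered sets of non-root vertices `α` and `β`,
with labels given by the tensor `x`. -/
noncomputable def ofForest₂ {α β : Type} [PartialOrder α] [PartialOrder β] [Finite α] [Finite β]
    (x : CTensorPow N (α ⊕ β)) : TreeSeries₂ N := fun a b =>
  if h : Nonempty (α ≃o a.Vert) ∧ Nonempty (β ≃o b.Vert) then
    SymQuot.mk N _
      (CTensorPow.relabel N (Equiv.sumCongr h.1.some.toEquiv h.2.some.toEquiv) x)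
  else 0

/-- The product `∘` of two labelled trees, which identifies the roots: the ordered set of non-root
vertices is the disjoint union (with no relations between the two parts). -/
noncomputable def circTree (a b : RTree) (x : LTree N a) (y : LTree N b) : TreeSeries N :=
  ofForest N (α := a.Vert ⊕ b.Vert)
    (CTensorPow.tmul N (SymQuot.rep N _ x) (SymQuot.rep N _ y))

/-- The product `∘` on the completed tree algebra (all sums are finite). -/
noncomputable def circ (x y : TreeSeries N) : TreeSeries N := fun u =>
  ∑ᶠ p : RTree × RTree, circTree N p.1 p.2 (x p.1) (y p.2) u

theorem finite_support_circ (x y : TreeSeries N) (u : RTree) :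
    (Function.support fun p : RTree × RTree =>
      circTree N p.1 p.2 (x p.1) (y p.2) u).Finite := by
  refine (RTree.finite_decompositions u).subset fun p hp => ?_
  by_contra h
  exact hp (dif_neg h)

/-- The tree `𝟏` that consists only of the root. -/
noncomputable def one : TreeSeries N :=
  ofForest N (α := Empty) (TensorPow.one N : CTensorPow N Empty)

/-- The power `x ^ (∘ k)`. -/
noncomputable def circPow (x : TreeSeries N) : ℕ → TreeSeries N
  | 0 => one N
  | k + 1 => circ N (circPow x k) x

open Classical in
/-- The Grossman-Larson coproduct of a labelled tree `x = x₁ ∘ ⋯ ∘ xₖ`: the sum over all sets `C`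
of children of the root of (the product of the branches of `x` starting in `C`) `⊗` (the product
of the other branches). -/
noncomputable def comulTree (t : RTree) (x : LTree N t) : TreeSeries₂ N :=
  ∑ᶠ C ∈ 𝒫 t.rootChildren,
    ofForest₂ N (α := t.branches C) (β := ((t.branches C)ᶜ : Set t.Vert))
      (CTensorPow.relabel N (Equiv.Set.sumCompl (t.branches C)).symm (SymQuot.rep N _ x))

/-- The Grossman-Larson coproduct on the completed tree algebra (all sums are finite). -/
noncomputable def comul (x : TreeSeries N) : TreeSeries₂ N := fun a b =>
  ∑ᶠ t : RTree, comulTree N t (x t) a b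

theorem finite_support_comul (x : TreeSeries N) (a b : RTree) :
    (Function.support fun t : RTree => comulTree N t (x t) a b).Finite := by
  classical
  refine Set.Subsingleton.finite ?_
  have key : ∀ t : RTree, comulTree N t (x t) a b ≠ 0 →
      Nonempty (t.Vert ≃o (a.Vert ⊕ b.Vert)) := by
    intro t ht
    by_contra hne
    apply ht
    unfold comulTree
    rw [finsum_mem_eq_finite_toFinset_sum _ (Set.toFinite _), Finset.sum_apply, Finset.sum_apply]
    refine Finset.sum_eq_zero fun C hC => dif_neg ?_
    rintro ⟨⟨f⟩, ⟨g⟩⟩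
    exact hne ⟨(t.splitIso C (by simpa using hC)).trans (f.sumCongr g)⟩
  intro s hs t ht
  obtain ⟨e⟩ := key s hs
  obtain ⟨f⟩ := key t ht
  exact RTree.eq_of_orderIso (e.trans f.symm)

/-- The tensor product `x ⊗ y` of two elements of the completed tree algebra. -/
noncomputable def tmul (x y : TreeSeries N) : TreeSeries₂ N := fun a b =>
  SymQuot.mk N _ (CTensorPow.tmul N (SymQuot.rep N _ (x a)) (SymQuot.rep N _ (y b)))

/-- Group-like elements of the completed Grossman-Larson Hopf algebra. -/
def IsGroupLike (x : TreeSeries N) : Prop := comul N x = tmul N x x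

open Classical in
/-- The projection `π_k` onto the trees whose root has exactly `k` children. -/
noncomputable def proj (k : ℕ) : TreeSeries N →ₗ[ℝ] TreeSeries N :=
  LinearMap.pi fun t => if t.numRootChildren = k then LinearMap.proj t else 0

/-- The subspace `I^{(n)}` of all elements supported on the trees of degree greater than `n`. -/
def truncIdeal (n : ℕ) : Submodule ℝ (TreeSeries N) where
  carrier := {x | ∀ t : RTree, t.deg ≤ n → x t = 0}
  add_mem' hx hy t ht := by rw [Pi.add_apply, hx t ht, hy t ht, add_zero]
  zero_mem' _ _ := rfl
  smul_mem' c x hx t ht := by rw [Pi.smul_apply, hx t ht, smul_zero]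

/-- The quotient by `I^{(n)}`. -/
abbrev Trunc (n : ℕ) : Type _ := TreeSeries N ⧸ truncIdeal N n

/-- The projection `π^{(n)}` onto the quotient by `I^{(n)}`. -/
noncomputable def trunc (n : ℕ) : TreeSeries N →ₗ[ℝ] Trunc N n := (truncIdeal N n).mkQ

open Classical in
/-- The identification of the quotient by `I^{(n)}` with the subspace of all elements supported on
the trees of degree at most `n`. -/
noncomputable def truncIncl (n : ℕ) : Trunc N n →ₗ[ℝ] TreeSeries N :=
  (truncIdeal N n).liftQ
    (LinearMap.pi fun t => if t.deg ≤ n then LinearMap.proj t else 0) (by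
      intro x hx
      rw [LinearMap.mem_ker]
      funext t
      by_cases h : t.deg ≤ n
      · simpa [h] using hx t h
      · simp [h])

/-- The projection `π^{(n)}_k = π^{(n)} ∘ π_k` onto the trees of degree at most `n` whose root has
exactly `k` children. -/
noncomputable def truncProj (n k : ℕ) (x : TreeSeries N) : TreeSeries N :=
  truncIncl N n (trunc N n (proj N k x))

end TreeSeries

end Tensor

/-! Write c(u; a, b) for the number of sets of root children of u that split u into the trees a and
b. All these splittings give the same class in the symmetrised quotient, so comparing the (a, b)
components of Δ(t) and t ⊗ t for u = a ∘ b yields t_a ⊗ t_b = c(u; a, b) t_u, an identity of tensors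
(`IsGroupLike.tmul_rep`). Multiplying k! π_k(t) by π_1(t) therefore gives, at a tree u with k + 1
root children, k! t_u times the sum of c(u; a, b) over all pairs with one root child in b. This sum
counts the choices of the single branch to split off, so it is k + 1
(`RTree.finsum_ncard_splittings`), and induction gives π_1(t)^{∘k} = k! π_k(t). Truncation does no
harm in degrees at most n, since the factors of u have degree at most that of u
(`IsGroupLike.circPow_truncProj`). The induction starts at the root-only tree: there the coefficient
c of t satisfies c² = c, and c ≠ 0 when t ≠ 0 (`IsGroupLike.apply_of_isEmpty`). -/

section CompletedTensorPowers

variable {V : Type*} [AddCommGroup V] [Module ℝ V] {I : Type*}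
variable {ξ : SeminormFamily ℝ V I} (N : SymmCrossSeminorms ξ)

/-! ### Relabelling, tensor products and symmetrisation on the completions. -/

namespace CTensorPow

variable {α β γ δ : Type} [Finite α] [Finite β] [Finite γ] [Finite δ]

theorem relabel_coe (e : α ≃ β) (a : TensorPow N α) :
    relabel N e (a : CTensorPow N α) = (TensorPow.relabel N e a : TensorPow N β) :=
  ContinuousLinearMap.completion_apply_coe _ _

/-- Like the other identities on completions below, this holds on the dense image of the algebraic
tensors and extends because both sides are continuous. -/
theorem relabel_relabel (e : α ≃ β) (f : β ≃ γ) (x : CTensorPow N α) :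
    relabel N f (relabel N e x) = relabel N (e.trans f) x := by
  refine Completion.induction_on x (isClosed_eq (by fun_prop) (by fun_prop)) fun a => ?_
  simp only [relabel_coe]
  congr 1
  exact PiTensorProduct.reindex_reindex (R := ℝ) (s := fun _ : α => V) e f a

theorem relabel_refl (x : CTensorPow N α) : relabel N (Equiv.refl α) x = x := by
  refine Completion.induction_on x (isClosed_eq (by fun_prop) (by fun_prop)) fun a => ?_
  rw [relabel_coe]
  congr 1
  change PiTensorProduct.reindex ℝ (fun _ : α => V) (Equiv.refl α) a = a
  rw [PiTensorProduct.reindex_refl]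
  rfl

theorem relabel_symm_relabel (e : α ≃ β) (x : CTensorPow N α) :
    relabel N e.symm (relabel N e x) = x := by
  rw [relabel_relabel, Equiv.self_trans_symm, relabel_refl]

theorem relabel_relabel_symm (e : α ≃ β) (x : CTensorPow N β) :
    relabel N e (relabel N e.symm x) = x := by
  rw [relabel_relabel, Equiv.symm_trans_self, relabel_refl]

theorem relabel_tmul (e : α ≃ γ) (f : β ≃ δ) (x : CTensorPow N α) (y : CTensorPow N β) :
    relabel N (Equiv.sumCongr e f) (tmul N x y) = tmul N (relabel N e x) (relabel N f y) := by
  refine Completion.induction_on₂ x y (isClosed_eq ?_ ?_) fun a b => ?_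
  · exact (relabel N _).continuous.comp (continuous_tmul N α β)
  · exact (continuous_tmul N γ δ).comp (((relabel N e).continuous.comp continuous_fst).prodMk
      ((relabel N f).continuous.comp continuous_snd))
  · simp only [relabel_coe, tmul_coe]
    congr 1
    exact SymmCrossSeminorms.reindex_tmulEquiv e f a b

theorem smul_tmul (c : ℝ) (x : CTensorPow N α) (y : CTensorPow N β) :
    tmul N (c • x) y = c • tmul N x y := by
  refine Completion.induction_on₂ x y (isClosed_eq ?_ ?_) fun a b => ?_
  · exact (continuous_tmul N α β).comp ((continuous_fst.const_smul c).prodMk continuous_snd)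
  · exact (continuous_tmul N α β).const_smul c
  · rw [← Completion.coe_smul, tmul_coe, tmul_coe, map_smul, LinearMap.smul_apply,
      Completion.coe_smul]

theorem tmul_smul (c : ℝ) (x : CTensorPow N α) (y : CTensorPow N β) :
    tmul N x (c • y) = c • tmul N x y := by
  refine Completion.induction_on₂ x y (isClosed_eq ?_ ?_) fun a b => ?_
  · exact (continuous_tmul N α β).comp (continuous_fst.prodMk (continuous_snd.const_smul c))
  · exact (continuous_tmul N α β).const_smul c
  · rw [← Completion.coe_smul, tmul_coe, tmul_coe, map_smul, Completion.coe_smul]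

/-- Homogeneity with scalar 0 suffices; additivity of `tmul` is not needed. -/
theorem zero_tmul (y : CTensorPow N β) : tmul N (0 : CTensorPow N α) y = 0 := by
  simpa using smul_tmul N 0 (0 : CTensorPow N α) y

theorem tmul_zero (x : CTensorPow N α) : tmul N x (0 : CTensorPow N β) = 0 := by
  simpa using tmul_smul N 0 x (0 : CTensorPow N β)

theorem sym_eq_sum (G : Subgroup (Equiv.Perm α)) [Fintype G] (x : CTensorPow N α) :
    sym N G x = (Nat.card G : ℝ)⁻¹ • ∑ σ : G, relabel N (σ : Equiv.Perm α) x := by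
  refine Completion.induction_on x (isClosed_eq (by fun_prop) ?_) fun a => ?_
  · exact (continuous_finsetSum Finset.univ fun (σ : G) _ =>
      (relabel N (σ : Equiv.Perm α)).continuous).const_smul ((Nat.card G : ℝ)⁻¹)
  · simp only [sym, ContinuousLinearMap.completion_apply_coe, relabel_coe]
    have hs : (∑ σ : G, ((TensorPow.relabel N (σ : Equiv.Perm α) a : TensorPow N α) :
        CTensorPow N α)) = ((∑ σ : G, TensorPow.relabel N (σ : Equiv.Perm α) a :
        TensorPow N α) : CTensorPow N α) :=
      (map_sum (Completion.toCompl (α := TensorPow N α)) _ _).symm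
    rw [hs, ← Completion.coe_smul]
    congr 1
    simp only [smul_apply, sum_apply]
    congr!

/-- Left translation by σ permutes the summands of the average; for `sym_relabel` it is right
translation. -/
theorem relabel_sym {G : Subgroup (Equiv.Perm α)} {σ : Equiv.Perm α} (hσ : σ ∈ G)
    (x : CTensorPow N α) : relabel N σ (sym N G x) = sym N G x := by
  have := Fintype.ofFinite G
  rw [sym_eq_sum, map_smul, map_sum]
  congr 1
  simp only [relabel_relabel]
  exact Equiv.sum_comp (Equiv.mulLeft (⟨σ, hσ⟩ : G)) fun τ : G => relabel N (τ : Equiv.Perm α) x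

theorem sym_relabel {G : Subgroup (Equiv.Perm α)} {σ : Equiv.Perm α} (hσ : σ ∈ G)
    (x : CTensorPow N α) : sym N G (relabel N σ x) = sym N G x := by
  have := Fintype.ofFinite G
  rw [sym_eq_sum, sym_eq_sum]
  congr 1
  simp only [relabel_relabel]
  exact Equiv.sum_comp (Equiv.mulRight (⟨σ, hσ⟩ : G)) fun τ : G => relabel N (τ : Equiv.Perm α) x

theorem sym_eq_self {G : Subgroup (Equiv.Perm α)} {x : CTensorPow N α}
    (hx : ∀ σ ∈ G, relabel N σ x = x) : sym N G x = x := by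
  have := Fintype.ofFinite G
  rw [sym_eq_sum, Finset.sum_congr rfl fun σ _ => hx σ.1 σ.property, Finset.sum_const, Finset.card_univ,
    ← Nat.card_eq_fintype_card, ← Nat.cast_smul_eq_nsmul ℝ, smul_smul,
    inv_mul_cancel₀ (by exact_mod_cast Nat.card_pos.ne'), one_smul]

end CTensorPow

/-! ### The completed tensor power over the empty set is ℝ. -/

theorem TensorPow.family_smul_one (i : Empty → I) (c : ℝ) :
    family N Empty i (c • one N) = |c| := by
  rw [map_smul_eq_mul, Real.norm_eq_abs]
  have h : family N Empty i (one N) = 1 := by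
    refine (N.seminorm_eq (Equiv.equivOfIsEmpty Empty (Fin 0)) i (one N)).trans ?_
    rw [← N.p_zero (i ∘ (Equiv.equivOfIsEmpty Empty (Fin 0)).symm)]
    congr 1
    refine (PiTensorProduct.reindex_tprod _ _).trans ?_
    congr 1
    funext j
    exact j.elim0
  rw [h, mul_one]

theorem TensorPow.isEmptyEquiv_smul_one (a : TensorPow N Empty) :
    PiTensorProduct.isEmptyEquiv (R := ℝ) (s := fun _ : Empty => V) Empty a • one N = a := by
  refine Eq.trans ?_ ((PiTensorProduct.isEmptyEquiv (R := ℝ)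
    (s := fun _ : Empty => V) Empty).symm_apply_apply a)
  rw [PiTensorProduct.isEmptyEquiv_symm_apply]
  change _ • PiTensorProduct.tprod ℝ _ = _
  congr 2
  funext j
  exact j.elim

/-- The coordinate functional on `V^{⊗ ∅} = ℝ`. -/
noncomputable def TensorPow.coord : TensorPow N Empty →L[ℝ] ℝ where
  toLinearMap := (PiTensorProduct.isEmptyEquiv (R := ℝ) (s := fun _ : Empty => V) Empty).toLinearMap
  cont := by
    refine (norm_withSeminorms ℝ ℝ).continuous_of_continuous_comp _ fun _ => ?_
    -- The absolute value of the coordinate is the cross seminorm itself. Its index map `Empty.elim`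
    -- exists even when `I` is empty.
    refine ((withSeminorms N Empty).continuous_seminorm Empty.elim).congr fun a => ?_
    conv_lhs => rw [← isEmptyEquiv_smul_one N a]
    exact family_smul_one N _ _

theorem TensorPow.coord_smul_one (a : TensorPow N Empty) : coord N a • one N = a :=
  isEmptyEquiv_smul_one N a

/-- Since ℝ is complete, the coordinate extends to the completion, which therefore adds no new
elements. -/
theorem CTensorPow.exists_eq_smul_one (x : CTensorPow N Empty) :
    ∃ c : ℝ, x = c • ((TensorPow.one N : TensorPow N Empty) : CTensorPow N Empty) := by
  have hL := (TensorPow.coord N).uniformContinuous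
  refine ⟨Completion.extension (TensorPow.coord N) x, ?_⟩
  refine Completion.induction_on x (isClosed_eq continuous_id ?_) fun a => ?_
  · simp only [← Completion.coe_smul]
    have hc : Continuous fun c : ℝ => c • TensorPow.one N := by fun_prop
    exact (Completion.continuous_coe _).comp (hc.comp Completion.continuous_extension)
  · rw [Completion.extension_coe hL, ← Completion.coe_smul, TensorPow.coord_smul_one]

/-- This is 1 ⊗ 1 = 1; it turns the group-like condition at the root-only tree into c² = c. -/
theorem CTensorPow.relabel_one_tmul_one (e : Empty ⊕ Empty ≃ Empty) :
    relabel N e (tmul N ((TensorPow.one N : TensorPow N Empty) : CTensorPow N Empty)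
      ((TensorPow.one N : TensorPow N Empty) : CTensorPow N Empty)) =
      ((TensorPow.one N : TensorPow N Empty) : CTensorPow N Empty) := by
  rw [tmul_coe, relabel_coe]
  congr 1
  change PiTensorProduct.reindex ℝ (fun _ : Empty ⊕ Empty => V) e
    (PiTensorProduct.tmulEquiv ℝ V (PiTensorProduct.tprod ℝ _ ⊗ₜ[ℝ] PiTensorProduct.tprod ℝ _)) =
    PiTensorProduct.tprod ℝ _
  rw [PiTensorProduct.tmulEquiv_apply, PiTensorProduct.reindex_tprod]
  congr 1
  funext x
  exact x.elim

/-! ### Symmetric representatives of classes. -/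

namespace SymQuot

variable {α : Type} [Finite α] (G : Subgroup (Equiv.Perm α))

theorem rep_injective : Function.Injective (rep N G) :=
  Function.LeftInverse.injective (mk_rep N G)

theorem relabel_rep {σ : Equiv.Perm α} (hσ : σ ∈ G) (x : SymQuot N G) :
    CTensorPow.relabel N σ (rep N G x) = rep N G x := by
  rw [← mk_rep N G x, rep_mk, CTensorPow.relabel_sym N hσ]

theorem mk_relabel {σ : Equiv.Perm α} (hσ : σ ∈ G) (x : CTensorPow N α) :
    mk N G (CTensorPow.relabel N σ x) = mk N G x := by
  apply rep_injective
  rw [rep_mk, rep_mk, CTensorPow.sym_relabel N hσ]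

end SymQuot

end CompletedTensorPowers

/-! ### Combinatorics of splitting a tree at its root. -/

namespace RTree

/-- This describes root children by the order on non-root vertices alone, so that it transfers along
order isomorphisms of forests. -/
theorem mem_rootChildren_iff {t : RTree} {w : t.Vert} : w ∈ t.rootChildren ↔ IsMin w := by
  constructor
  · intro hw v hvw
    by_contra hwv
    have hlt : v < w := lt_of_le_not_ge hvw hwv
    exact hw.2 (lt_of_le_of_ne (t.rep.root_le _) (Ne.symm v.2)) hlt
  · intro hw
    refine ⟨lt_of_le_of_ne (t.rep.root_le _) (Ne.symm w.2), fun c hc hcw => ?_⟩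
    exact hw.not_lt (b := ⟨c, hc.ne'⟩) hcw

theorem numRootChildren_eq_ncard {α : Type} [PartialOrder α] {t : RTree} (e : α ≃o t.Vert) :
    t.numRootChildren = {v : α | IsMin v}.ncard := by
  have h : t.rootChildren = e '' {v : α | IsMin v} := by
    ext w
    obtain ⟨v, rfl⟩ := e.surjective w
    rw [mem_rootChildren_iff, e.injective.mem_set_image, Set.mem_ofPred_eq, e.isMin_apply]
  rw [numRootChildren, h, Set.ncard_image_of_injective _ e.injective]

theorem isEmpty_vert_of_numRootChildren_eq_zero {t : RTree} (h : t.numRootChildren = 0) :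
    IsEmpty t.Vert := by
  refine ⟨fun v => ?_⟩
  obtain ⟨m, -, hm⟩ := (Set.finite_univ (α := t.Vert)).exists_le_minimal (Set.mem_univ v)
  rw [numRootChildren, Set.ncard_eq_zero (Set.toFinite _)] at h
  have : m ∈ t.rootChildren := mem_rootChildren_iff.2 fun b hb => hm.2 (Set.mem_univ b) hb
  simp [h] at this

/-- The branches starting in a set of children of the root have exactly these children as minimal
elements. -/
theorem ncard_isMin_branches {t : RTree} {C : Set t.Vert} (hC : C ⊆ t.rootChildren) :
    {v : t.branches C | IsMin v}.ncard = C.ncard := by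
  have h : Subtype.val '' {v : t.branches C | IsMin v} = C := by
    ext w
    constructor
    · rintro ⟨v, hv, rfl⟩
      obtain ⟨c, hc, hcv⟩ := v.2
      have hvc : v.1 ≤ c := hv (b := ⟨c, c, hc, le_rfl⟩) hcv
      rwa [le_antisymm hvc hcv]
    · intro hw
      exact ⟨⟨w, w, hw, le_rfl⟩, fun b hb => mem_rootChildren_iff.1 (hC hw) hb, rfl⟩
  rw [← Set.ncard_image_of_injective _ Subtype.val_injective, h]

/-- A finite forest is the set of non-root vertices of a tree. -/
theorem exists_orderIso_vert (α : Type) [PartialOrder α] [Finite α]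
    (h : ∀ v : α, IsChain (· ≤ ·) (Set.Iio v)) : ∃ a : RTree, Nonempty (α ≃o a.Vert) := by
  -- The root is an added bottom element.
  let T : RootedPoset :=
    { carrier := WithBot α
      finite := inferInstanceAs (Finite (Option α))
      existsUnique_isMin := ⟨⊥, isMin_bot, fun m hm => hm.eq_bot⟩
      isChain_Iio := by
        rintro v a ha b hb hab
        induction a with
        | bot => exact Or.inl bot_le
        | coe a =>
          induction b with
          | bot => exact Or.inr bot_le
          | coe b =>
            induction v with
            | bot => exact absurd (Set.mem_Iio.1 ha) not_lt_bot
            | coe v =>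
              have := h v (WithBot.coe_lt_coe.1 ha) (WithBot.coe_lt_coe.1 hb)
                fun h => hab (congrArg _ h)
              simpa using this }
  have hT : T.root = (⊥ : WithBot α) := le_antisymm (T.root_le (⊥ : WithBot α)) bot_le
  let a : RTree := Quotient.mk _ T
  have hTa : T ≈ a.rep := Setoid.symm (Quotient.mk_out (s := RootedPoset.setoid) T)
  obtain ⟨g⟩ := hTa
  -- The fixed representative of the class is only isomorphic to `T`; the isomorphism restricts to
  -- non-root vertices because it preserves the root.
  have hg : g (⊥ : WithBot α) = a.rep.root := by
    rw [← hT]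
    refine le_antisymm ?_ (a.rep.root_le _)
    rw [← g.le_symm_apply]
    exact T.root_le _
  let f : α → a.Vert := fun v => ⟨g (v : WithBot α), fun hv =>
    WithBot.coe_ne_bot (g.injective (hv.trans hg.symm))⟩
  have hf : ∀ v w, f v ≤ f w ↔ v ≤ w := fun v w => g.le_iff_le.trans WithBot.coe_le_coe
  refine ⟨a, ⟨RelIso.ofSurjective (OrderEmbedding.ofMapLEIff f hf) ?_⟩⟩
  rintro ⟨w, hw⟩
  obtain ⟨v, rfl⟩ := g.surjective w
  induction v using WithBot.recBotCoe with
  | bot => exact absurd hg hw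
  | coe v => exact ⟨v, rfl⟩

theorem exists_orderIso_vert_of_set {t : RTree} (S : Set t.Vert) :
    ∃ a : RTree, Nonempty (S ≃o a.Vert) := by
  refine exists_orderIso_vert S fun v a ha b hb hab => ?_
  exact t.rep.isChain_Iio v.1.1 (x := a.1.1) ha (y := b.1.1) hb
    fun h => hab (Subtype.ext (Subtype.ext h))

theorem deg_le_of_orderIso {a b t : RTree}
    (e : (a.Vert ⊕ b.Vert) ≃o t.Vert) : a.deg ≤ t.deg ∧ b.deg ≤ t.deg := by
  have h : t.deg = a.deg + b.deg := by
    rw [deg, ← Nat.card_congr e.toEquiv, Nat.card_sum]; rfl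
  omega

/-- The sets of children of the root of `u` whose branches form the tree `a`, while the other
branches form the tree `b`. -/
def splittings (u a b : RTree) : Set (Set u.Vert) :=
  {C | C ⊆ u.rootChildren ∧ Nonempty (u.branches C ≃o a.Vert) ∧
    Nonempty (((u.branches C)ᶜ : Set u.Vert) ≃o b.Vert)}

/-- With `finite_decompositions`, this makes sums of splitting numbers over all pairs of trees
finite. -/
theorem splittings_eq_empty {u a b : RTree} (h : ¬ Nonempty ((a.Vert ⊕ b.Vert) ≃o u.Vert)) :
    splittings u a b = ∅ := by
  rw [Set.eq_empty_iff_forall_notMem]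
  rintro C ⟨hC, ⟨f⟩, ⟨g⟩⟩
  exact h ⟨((u.splitIso C hC).trans (f.sumCongr g)).symm⟩

/-- The splitting number is thus nonzero and can be cancelled. The two summands are unrelated in the
order, so the minimal elements of the image of `a` generate exactly that image. -/
theorem splittings_nonempty {u a b : RTree} (e : (a.Vert ⊕ b.Vert) ≃o u.Vert) :
    (splittings u a b).Nonempty := by
  set C : Set u.Vert := {v | IsMin v ∧ v ∈ Set.range fun x => e (Sum.inl x)} with hC
  have hbr : u.branches C = Set.range fun x => e (Sum.inl x) := by
    ext v
    constructor
    · rintro ⟨_, ⟨-, c, rfl⟩, hcv⟩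
      obtain ⟨w, rfl⟩ := e.surjective v
      rcases w with w | w
      · exact ⟨w, rfl⟩
      · simp at hcv
    · rintro ⟨x, rfl⟩
      obtain ⟨m, hmx, hm⟩ := (Set.finite_univ (α := a.Vert)).exists_le_minimal (Set.mem_univ x)
      refine ⟨e (Sum.inl m), ⟨?_, m, rfl⟩, by simpa using hmx⟩
      rw [e.isMin_apply]
      rintro (w | w) hw
      · exact Sum.inl_le_inl_iff.2 (hm.2 (Set.mem_univ w) (Sum.inl_le_inl_iff.1 hw))
      · simp at hw
  have hbr' : (u.branches C)ᶜ = Set.range fun x => e (Sum.inr x) := by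
    rw [hbr]
    ext v
    obtain ⟨w | w, rfl⟩ := e.surjective v <;> simp
  refine ⟨C, fun v hv => mem_rootChildren_iff.2 hv.1, ?_, ?_⟩
  · exact ⟨(OrderIso.setCongr _ _ hbr).trans
      (OrderEmbedding.ofMapLEIff (fun x => e (Sum.inl x)) (by simp)).orderIso.symm⟩
  · exact ⟨(OrderIso.setCongr _ _ hbr').trans
      (OrderEmbedding.ofMapLEIff (fun x => e (Sum.inr x)) (by simp)).orderIso.symm⟩

theorem numRootChildren_of_mem_splittings {u a b : RTree} {C : Set u.Vert}
    (hC : C ∈ splittings u a b) :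
    a.numRootChildren = C.ncard ∧ b.numRootChildren = (u.rootChildren \ C).ncard := by
  obtain ⟨hC, ⟨f⟩, ⟨g⟩⟩ := hC
  constructor
  · rw [numRootChildren_eq_ncard f, ncard_isMin_branches hC]
  · rw [numRootChildren_eq_ncard ((OrderIso.setCongr _ _ (u.compl_branches C hC)).symm.trans g),
      ncard_isMin_branches Set.sdiff_subset]

/-- Splitting off one branch of a tree is possible in as many ways as the root has children. -/
theorem finsum_ncard_splittings (u : RTree) (k : ℕ) :
    ∑ᶠ p : RTree × RTree, (if p.1.numRootChildren = k ∧ p.2.numRootChildren = 1 then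
      (splittings u p.1 p.2).ncard else 0) = if u.numRootChildren = k + 1 then k + 1 else 0 := by
  classical
  have := Fintype.ofFinite u.Vert
  choose φ hφ using fun S : Set u.Vert => exists_orderIso_vert_of_set S
  -- Isomorphic trees are equal, so each set `C` of root children is a splitting for exactly one
  -- pair, namely `ψ C`.
  let ψ : Set u.Vert → RTree × RTree := fun C => (φ (u.branches C), φ (u.branches C)ᶜ)
  have hψ : ∀ C a b, C ∈ splittings u a b ↔ C ⊆ u.rootChildren ∧ ψ C = (a, b) := by
    intro C a b
    refine and_congr_right fun hC => ?_
    simp only [ψ, Prod.mk.injEq]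
    refine and_congr ⟨fun h => ?_, ?_⟩ ⟨fun h => ?_, ?_⟩
    · exact eq_of_orderIso ((hφ (u.branches C)).some.symm.trans h.some)
    · rintro rfl; exact hφ _
    · exact eq_of_orderIso ((hφ (u.branches C)ᶜ).some.symm.trans h.some)
    · rintro rfl; exact hφ _
  let S : Finset (Set u.Vert) := {C | C ⊆ u.rootChildren ∧ C.ncard = k ∧
    (u.rootChildren \ C).ncard = 1}
  have hterm : ∀ p : RTree × RTree,
      (if p.1.numRootChildren = k ∧ p.2.numRootChildren = 1 then
        (splittings u p.1 p.2).ncard else 0) = ∑ C ∈ S, if ψ C = p then 1 else 0 := by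
    rintro ⟨a, b⟩
    rw [← Finset.sum_filter, ← Finset.card_eq_sum_ones]
    split_ifs with h
    · rw [← Set.ncard_coe_finset]
      congr 1
      ext C
      simp only [S, Finset.coe_filter, Finset.mem_filter_univ, Set.mem_ofPred_eq]
      constructor
      · intro hC
        have h1 := numRootChildren_of_mem_splittings hC
        have h2 := (hψ _ _ _).1 hC
        exact ⟨⟨h2.1, h1.1 ▸ h.1, h1.2 ▸ h.2⟩, h2.2⟩
      · rintro ⟨h1, h2⟩
        exact (hψ _ _ _).2 ⟨h1.1, h2⟩
    · symm
      rw [Finset.card_eq_zero, Finset.filter_eq_empty_iff]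
      intro C hC hp
      simp only [S, Finset.mem_filter_univ] at hC
      have h1 := numRootChildren_of_mem_splittings ((hψ _ _ _).2 ⟨hC.1, hp⟩)
      exact h ⟨h1.1.trans hC.2.1, h1.2.trans hC.2.2⟩
  rw [finsum_congr hterm, finsum_eq_sum_of_support_subset (s := S.image ψ)]
  -- After exchanging the sums, each `C` is counted once, at the pair `ψ C`, and the total is the
  -- cardinality of `S`.
  · rw [Finset.sum_comm, Finset.sum_congr rfl fun C hC => Finset.sum_ite_eq (S.image ψ) (ψ C) _,
      Finset.sum_congr rfl fun C hC => if_pos (Finset.mem_image_of_mem ψ hC),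
      ← Finset.card_eq_sum_ones]
    have hcard : ∀ C : Set u.Vert, C ⊆ u.rootChildren →
        (u.rootChildren \ C).ncard + C.ncard = u.numRootChildren :=
      fun C hC => Set.ncard_sdiff_add_ncard_of_subset hC
    split_ifs with h
    -- With k + 1 root children, a set of size k automatically leaves exactly one out.
    · have hS : S.card = (Finset.powersetCard k u.rootChildren.toFinset).card := by
        refine Finset.card_bij (fun C _ => C.toFinset) ?_ ?_ ?_
        · intro C hC
          simp only [S, Finset.mem_filter_univ] at hC
          rw [Finset.mem_powersetCard, Set.toFinset_subset_toFinset, ← Set.ncard_eq_toFinset_card']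
          exact ⟨hC.1, hC.2.1⟩
        · intro C _ D _ hCD
          simpa using hCD
        · intro D hD
          rw [Finset.mem_powersetCard] at hD
          have hD' : (D : Set u.Vert) ⊆ u.rootChildren := by
            intro x hx
            simpa using hD.1 hx
          refine ⟨D, ?_, by simp⟩
          have := hcard D hD'
          simp only [S, Finset.mem_filter_univ]
          rw [Set.ncard_coe_finset] at *
          exact ⟨hD', hD.2, by omega⟩
      rw [hS, Finset.card_powersetCard, ← Set.ncard_eq_toFinset_card']
      change u.numRootChildren.choose k = _
      rw [h, Nat.choose_succ_self_right]
    · rw [Finset.card_eq_zero, Finset.eq_empty_iff_forall_notMem]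
      intro C hC
      simp only [S, Finset.mem_filter_univ] at hC
      have := hcard C hC.1
      omega
  · intro p hp
    obtain ⟨C, hC, hCp⟩ := Finset.exists_ne_zero_of_sum_ne_zero hp
    rw [Finset.coe_image]
    exact ⟨C, hC, by_contra fun h => hCp (if_neg h)⟩

end RTree

/-! ### Components of products and coproducts. -/

namespace TreeSeries

variable {V : Type*} [AddCommGroup V] [Module ℝ V] {I : Type*}
variable {ξ : SeminormFamily ℝ V I} (N : SymmCrossSeminorms ξ)

theorem orderIso_trans_symm_mem_symmetryGroup {α β : Type} [PartialOrder α] [PartialOrder β]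
    (e f : α ≃o β) : e.toEquiv.symm.trans f.toEquiv ∈ symmetryGroup β :=
  fun v w => (e.symm.trans f).le_iff_le (x := v) (y := w)

/-- Two isomorphisms differ by an automorphism of the tree, which fixes the symmetric
representative. Hence the arbitrary isomorphisms chosen in the definitions are harmless. -/
theorem relabel_rep_eq {u : RTree} {α : Type} [PartialOrder α] [Finite α] (e f : u.Vert ≃o α)
    (x : LTree N u) : CTensorPow.relabel N e.toEquiv (SymQuot.rep N _ x) =
      CTensorPow.relabel N f.toEquiv (SymQuot.rep N _ x) := by
  have h := SymQuot.relabel_rep N _ (orderIso_trans_symm_mem_symmetryGroup f.symm e.symm) x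
  rw [← CTensorPow.relabel_symm_relabel N e.symm.toEquiv
    (CTensorPow.relabel N f.toEquiv (SymQuot.rep N _ x)), CTensorPow.relabel_relabel N f.toEquiv]
  exact (congrArg (CTensorPow.relabel N e.toEquiv) h).symm

theorem ofForest_apply {α : Type} [PartialOrder α] [Finite α] {u : RTree} (e : α ≃o u.Vert)
    (x : CTensorPow N α) :
    ofForest N x u = SymQuot.mk N _ (CTensorPow.relabel N e.toEquiv x) := by
  have h : Nonempty (α ≃o u.Vert) := ⟨e⟩
  rw [ofForest, dif_pos h, ← SymQuot.mk_relabel N _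
    (orderIso_trans_symm_mem_symmetryGroup h.some e), CTensorPow.relabel_relabel]
  congr 3
  ext v
  simp

theorem ofForest_apply_eq_zero {α : Type} [PartialOrder α] [Finite α] {u : RTree}
    (h : ¬ Nonempty (α ≃o u.Vert)) (x : CTensorPow N α) : ofForest N x u = 0 :=
  dif_neg h

theorem ofForest_zero {α : Type} [PartialOrder α] [Finite α] :
    ofForest N (0 : CTensorPow N α) = 0 := by
  funext u
  by_cases h : Nonempty (α ≃o u.Vert)
  · rw [ofForest_apply N h.some, map_zero, map_zero]; rfl
  · exact ofForest_apply_eq_zero N h _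

theorem circ_zero (x : TreeSeries N) : circ N x 0 = 0 := by
  funext u
  have : ∀ p : RTree × RTree, circTree N p.1 p.2 (x p.1) ((0 : TreeSeries N) p.2) u = 0 := by
    intro p
    rw [circTree, Pi.zero_apply, map_zero, CTensorPow.tmul_zero, ofForest_zero]
    rfl
  rw [circ, finsum_congr this, finsum_zero]
  rfl

/-- Automorphisms of the two parts combine to an automorphism of u, so invariance under SG(u) gives
invariance under SG(a) × SG(b). -/
theorem relabel_rep_of_mem_symmetryGroupProd {u a b : RTree} (e : (a.Vert ⊕ b.Vert) ≃o u.Vert)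
    (x : LTree N u) {σ : Equiv.Perm (a.Vert ⊕ b.Vert)} (hσ : σ ∈ symmetryGroupProd a.Vert b.Vert) :
    CTensorPow.relabel N σ (CTensorPow.relabel N e.symm.toEquiv (SymQuot.rep N _ x)) =
      CTensorPow.relabel N e.symm.toEquiv (SymQuot.rep N _ x) := by
  obtain ⟨⟨σ, τ⟩, ⟨hσ, hτ⟩, rfl⟩ := hσ
  let s : a.Vert ≃o a.Vert := ⟨σ, hσ _ _⟩
  let t : b.Vert ≃o b.Vert := ⟨τ, hτ _ _⟩
  rw [CTensorPow.relabel_relabel]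
  exact relabel_rep_eq N (e.symm.trans (s.sumCongr t)) e.symm x

theorem relabel_tmul_rep {a b : RTree} (x : LTree N a) (y : LTree N b)
    {σ : Equiv.Perm (a.Vert ⊕ b.Vert)} (hσ : σ ∈ symmetryGroupProd a.Vert b.Vert) :
    CTensorPow.relabel N σ (CTensorPow.tmul N (SymQuot.rep N _ x) (SymQuot.rep N _ y)) =
      CTensorPow.tmul N (SymQuot.rep N _ x) (SymQuot.rep N _ y) := by
  obtain ⟨⟨σ, τ⟩, ⟨hσ, hτ⟩, rfl⟩ := hσ
  refine (CTensorPow.relabel_tmul N σ τ _ _).trans ?_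
  rw [SymQuot.relabel_rep N _ hσ, SymQuot.relabel_rep N _ hτ]

/-- By `relabel_rep_eq` every splitting contributes the same class, so only their number matters. -/
theorem comulTree_apply {u a b : RTree} (e : (a.Vert ⊕ b.Vert) ≃o u.Vert) (x : LTree N u) :
    comulTree N u x a b = (RTree.splittings u a b).ncard • SymQuot.mk N _
      (CTensorPow.relabel N e.symm.toEquiv (SymQuot.rep N _ x)) := by
  classical
  rw [comulTree, finsum_mem_eq_finite_toFinset_sum _ (Set.toFinite _), Finset.sum_apply,
    Finset.sum_apply]
  have hterm : ∀ C ∈ (Set.toFinite (𝒫 u.rootChildren)).toFinset,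
      ofForest₂ N (α := u.branches C) (β := ((u.branches C)ᶜ : Set u.Vert))
        (CTensorPow.relabel N (Equiv.Set.sumCompl (u.branches C)).symm (SymQuot.rep N _ x)) a b =
      if C ∈ RTree.splittings u a b then SymQuot.mk N _
        (CTensorPow.relabel N e.symm.toEquiv (SymQuot.rep N _ x)) else 0 := by
    intro C hC
    have hC' : C ⊆ u.rootChildren := by simpa using hC
    by_cases h : Nonempty (u.branches C ≃o a.Vert) ∧
        Nonempty (((u.branches C)ᶜ : Set u.Vert) ≃o b.Vert)
    · rw [ofForest₂, dif_pos h, if_pos ⟨hC', h⟩, CTensorPow.relabel_relabel]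
      congr 1
      exact relabel_rep_eq N ((u.splitIso C hC').trans (h.1.some.sumCongr h.2.some)) e.symm x
    · rw [ofForest₂, dif_neg h, if_neg fun h' => h h'.2]
  rw [Finset.sum_congr rfl hterm, ← Finset.sum_filter, Finset.sum_const]
  congr 1
  rw [← Set.ncard_coe_finset]
  congr 1
  ext C
  simp only [Finset.coe_filter, Set.Finite.mem_toFinset, Set.mem_powerset_iff, Set.mem_ofPred_eq,
    and_iff_right_iff_imp]
  exact fun h => h.1

/-- Only one tree contributes to the component at `a`, `b`: any tree that splits into them is
isomorphic, hence equal, to `u`. -/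
theorem comul_apply {u a b : RTree} (e : (a.Vert ⊕ b.Vert) ≃o u.Vert) (x : TreeSeries N) :
    comul N x a b = (RTree.splittings u a b).ncard • SymQuot.mk N _
      (CTensorPow.relabel N e.symm.toEquiv (SymQuot.rep N _ (x u))) := by
  rw [← comulTree_apply N e, comul]
  refine finsum_eq_single _ u fun v hv => ?_
  by_contra hne
  refine hv ?_
  unfold comulTree at hne
  rw [finsum_mem_eq_finite_toFinset_sum _ (Set.toFinite _), Finset.sum_apply,
    Finset.sum_apply] at hne
  obtain ⟨C, hC, hCne⟩ := Finset.exists_ne_zero_of_sum_ne_zero hne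
  have hC' : C ⊆ v.rootChildren := by simpa using hC
  have h : Nonempty (v.branches C ≃o a.Vert) ∧
      Nonempty (((v.branches C)ᶜ : Set v.Vert) ≃o b.Vert) := by
    by_contra h
    exact hCne (dif_neg h)
  exact RTree.eq_of_orderIso (((v.splitIso C hC').trans (h.1.some.sumCongr h.2.some)).trans e)

/-! ### Group-like elements. -/

variable {N}

/-- The components of a group-like element at `a`, `b` and `a ∘ b`. -/
theorem IsGroupLike.tmul_rep {t : TreeSeries N} (ht : t.IsGroupLike N) {u a b : RTree}
    (e : (a.Vert ⊕ b.Vert) ≃o u.Vert) :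
    CTensorPow.relabel N e.toEquiv
      (CTensorPow.tmul N (SymQuot.rep N _ (t a)) (SymQuot.rep N _ (t b))) =
      (RTree.splittings u a b).ncard • SymQuot.rep N _ (t u) := by
  have h : comul N t a b = TreeSeries.tmul N t t a b := congrFun (congrFun ht a) b
  rw [comul_apply N e] at h
  have h' := congrArg (SymQuot.rep N _) h
  -- Both tensors are already invariant under SG(a) × SG(b), so symmetrisation drops out and the
  -- equality of classes becomes one of tensors.
  rw [map_nsmul, SymQuot.rep_mk, TreeSeries.tmul, SymQuot.rep_mk,
    CTensorPow.sym_eq_self N fun σ hσ => relabel_rep_of_mem_symmetryGroupProd N e _ hσ,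
    CTensorPow.sym_eq_self N fun σ hσ => relabel_tmul_rep N _ _ hσ] at h'
  rw [← h', map_nsmul]
  congr 1
  exact CTensorPow.relabel_relabel_symm N e.toEquiv _

theorem IsGroupLike.apply_of_isEmpty {t : TreeSeries N} (ht : t.IsGroupLike N) (h0 : t ≠ 0)
    {u : RTree} (hu : IsEmpty u.Vert) : t u = one N u := by
  let ε : Empty ≃o u.Vert := ⟨Equiv.equivOfIsEmpty _ _, fun {x} => x.elim⟩
  obtain ⟨v, hv⟩ := Function.ne_iff.1 h0
  have hu0 : SymQuot.rep N _ (t u) ≠ 0 := by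
    intro hu0
    -- The root-only tree is a unit for `∘`: if `t u` vanished, a positive multiple of `t v` would
    -- be `t u ⊗ t v = 0`.
    let e : (u.Vert ⊕ v.Vert) ≃o v.Vert :=
      OrderIso.symm ⟨(Equiv.emptySum u.Vert v.Vert).symm, by simp⟩
    have h := ht.tmul_rep e
    rw [hu0, CTensorPow.zero_tmul, map_zero, ← Nat.cast_smul_eq_nsmul ℝ, eq_comm,
      smul_eq_zero, Nat.cast_eq_zero, Set.ncard_eq_zero (Set.toFinite _)] at h
    rcases h with h | h
    · exact (RTree.splittings_nonempty e).ne_empty h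
    · exact hv (SymQuot.rep_injective N _ (h.trans (map_zero _).symm))
  let e : (u.Vert ⊕ u.Vert) ≃o u.Vert :=
    ⟨Equiv.equivOfIsEmpty _ _, fun {x} => isEmptyElim x⟩
  have h1 : (RTree.splittings u u u).ncard = 1 := by
    obtain ⟨C, hC⟩ := RTree.splittings_nonempty e
    refine Set.ncard_eq_one.2 ⟨C, Set.eq_singleton_iff_unique_mem.2 ⟨hC, fun D _ => ?_⟩⟩
    exact Subsingleton.elim _ _
  have h := ht.tmul_rep e
  rw [h1, one_smul] at h
  obtain ⟨c, hc⟩ := CTensorPow.exists_eq_smul_one N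
    (CTensorPow.relabel N ε.toEquiv.symm (SymQuot.rep N _ (t u)))
  have hc' : SymQuot.rep N _ (t u) = c • CTensorPow.relabel N ε.toEquiv
      ((TensorPow.one N : TensorPow N Empty) : CTensorPow N Empty) := by
    rw [← map_smul, ← hc, CTensorPow.relabel_relabel_symm]
  have hone : CTensorPow.relabel N e.toEquiv (CTensorPow.tmul N
      (CTensorPow.relabel N ε.toEquiv ((TensorPow.one N : TensorPow N Empty) : CTensorPow N Empty))
      (CTensorPow.relabel N ε.toEquiv
        ((TensorPow.one N : TensorPow N Empty) : CTensorPow N Empty))) =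
      CTensorPow.relabel N ε.toEquiv
        ((TensorPow.one N : TensorPow N Empty) : CTensorPow N Empty) := by
    rw [← CTensorPow.relabel_tmul, CTensorPow.relabel_relabel]
    conv_rhs => rw [← CTensorPow.relabel_one_tmul_one N (Equiv.equivOfIsEmpty _ _),
      CTensorPow.relabel_relabel]
    congr 2
    exact Subsingleton.elim _ _
  rw [hc', CTensorPow.smul_tmul, CTensorPow.tmul_smul, map_smul, map_smul, hone] at h
  have hc0 : c ≠ 0 := by
    rintro rfl
    exact hu0 (by rw [hc', zero_smul])
  -- Here `h` reads c · c · 1 = c · 1; one factor c is cancelled.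
  have h2 := smul_right_injective _ hc0 h
  rw [← hc'] at h2
  change SymQuot.rep N _ (t u) = _ at h2
  rw [one, ofForest_apply N ε, ← h2, SymQuot.mk_rep]

theorem truncProj_apply (n k : ℕ) (x : TreeSeries N) (u : RTree) :
    truncProj N n k x u = if u.deg ≤ n ∧ u.numRootChildren = k then x u else 0 := by
  classical
  change (LinearMap.pi fun t => if t.deg ≤ n then LinearMap.proj t else 0 :
    TreeSeries N →ₗ[ℝ] TreeSeries N) (proj N k x) u = _
  rw [LinearMap.pi_apply]
  by_cases h : u.deg ≤ n <;> by_cases h' : u.numRootChildren = k <;> simp [proj, h, h']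

/-- The degree bound is essential: products of truncated factors can have components of degree above
n, which need not agree with the truncation of `t`. The bound passes to both factors of `u`, so the
induction goes through with `u` varying. -/
theorem IsGroupLike.circPow_truncProj {t : TreeSeries N} (ht : t.IsGroupLike N) (h0 : t ≠ 0)
    (n k : ℕ) {u : RTree} (hu : u.deg ≤ n) :
    circPow N (truncProj N n 1 t) k u = if u.numRootChildren = k then k.factorial • t u else 0 := by
  induction k generalizing u with
  | zero =>
    rw [circPow]
    split_ifs with h
    · rw [Nat.factorial_zero, one_smul,
        ht.apply_of_isEmpty h0 (RTree.isEmpty_vert_of_numRootChildren_eq_zero h)]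
    · refine ofForest_apply_eq_zero N (fun ⟨ε⟩ => h ?_) _
      rw [RTree.numRootChildren_eq_ncard ε, Set.eq_empty_of_isEmpty {v : Empty | IsMin v},
        Set.ncard_empty]
  | succ k ih =>
    -- Each summand is an integer multiple of the same vector, so the sum over pairs reduces to
    -- counting splittings.
    have hterm : ∀ p : RTree × RTree, circTree N p.1 p.2 (circPow N (truncProj N n 1 t) k p.1)
        (truncProj N n 1 t p.2) u =
        (if p.1.numRootChildren = k ∧ p.2.numRootChildren = 1 then
          (RTree.splittings u p.1 p.2).ncard else 0) • (k.factorial • t u) := by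
      rintro ⟨a, b⟩
      by_cases hab : Nonempty ((a.Vert ⊕ b.Vert) ≃o u.Vert)
      · obtain ⟨e⟩ := hab
        obtain ⟨ha, hb⟩ := RTree.deg_le_of_orderIso e
        rw [circTree, ofForest_apply N e, ih (ha.trans hu), truncProj_apply]
        simp only [hb.trans hu, true_and]
        by_cases h1 : a.numRootChildren = k
        · by_cases h2 : b.numRootChildren = 1
          · rw [if_pos h1, if_pos h2, if_pos ⟨h1, h2⟩, map_nsmul,
              ← Nat.cast_smul_eq_nsmul ℝ k.factorial (SymQuot.rep N _ (t a)), CTensorPow.smul_tmul,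
              map_smul, ht.tmul_rep e, map_smul, map_nsmul, SymQuot.mk_rep,
              Nat.cast_smul_eq_nsmul, smul_comm]
          · rw [if_neg h2, if_neg fun h : _ ∧ _ => h2 h.2, map_zero (SymQuot.rep N _),
              CTensorPow.tmul_zero, map_zero, map_zero, zero_smul]
        · rw [if_neg h1, if_neg fun h : _ ∧ _ => h1 h.1, map_zero (SymQuot.rep N _),
            CTensorPow.zero_tmul, map_zero, map_zero, zero_smul]
      · rw [circTree, ofForest_apply_eq_zero N hab, RTree.splittings_eq_empty hab,
          Set.ncard_empty, ite_self, zero_smul]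
    have hfin : (Function.support fun p : RTree × RTree =>
        if p.1.numRootChildren = k ∧ p.2.numRootChildren = 1 then
          (RTree.splittings u p.1 p.2).ncard else 0).Finite := by
      refine u.finite_decompositions.subset fun p hp => ?_
      by_contra h
      refine hp ?_
      simp only [RTree.splittings_eq_empty h, Set.ncard_empty, ite_self]
    rw [circPow, circ, finsum_congr hterm, ← finsum_smul' hfin, RTree.finsum_ncard_splittings, ite_smul,
      zero_smul, smul_smul, ← Nat.factorial_succ]

end TreeSeries

theorem mainTheorem6 {V : Type*} [AddCommGroup V] [Module ℝ V] [TopologicalSpace V]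
    {I : Type*} (ξ : SeminormFamily ℝ V I) (hξ : WithSeminorms ξ) (N : SymmCrossSeminorms ξ)
    (t : TreeSeries N) (ht : t.IsGroupLike N) (n k : ℕ) (hk : k = 0 → t ≠ 0) :
    ∃ r : TreeSeries N,
      TreeSeries.truncProj N n k t =
        (k.factorial : ℝ)⁻¹ • TreeSeries.circPow N (TreeSeries.truncProj N n 1 t) k + r ∧
      TreeSeries.trunc N n r = 0 := by
  -- The remainder is the difference of the two sides; it has to vanish only in degrees at most n.
  refine ⟨_, (add_sub_cancel _ _).symm, ?_⟩
  refine (Submodule.Quotient.mk_eq_zero _).2 fun u hu => ?_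
  rw [Pi.sub_apply, Pi.smul_apply, sub_eq_zero, TreeSeries.truncProj_apply]
  simp only [hu, true_and]
  -- The zero element is group-like too, but its component at the root-only tree is not 1. Here k ≥
  -- 1, and positive powers of 0 vanish.
  by_cases h0 : t = 0
  · obtain ⟨k, rfl⟩ := Nat.exists_eq_succ_of_ne_zero fun hk0 => hk hk0 h0
    subst h0
    have hx : TreeSeries.truncProj N n 1 (0 : TreeSeries N) = 0 := by
      simp [TreeSeries.truncProj]
    rw [TreeSeries.circPow, hx, TreeSeries.circ_zero]
    simp
  · rw [ht.circPow_truncProj h0 n k hu]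
    split_ifs
    · rw [← Nat.cast_smul_eq_nsmul ℝ, smul_smul,
        inv_mul_cancel₀ (by exact_mod_cast k.factorial_ne_zero), one_smul]
    · rw [smul_zero]
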